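/- Let $\mathbb H$ be the first Heisenberg group, that is, $\mathbb R^3$ with the sub-Riemannian structure for which $X_1=\partial_x-\frac y2\partial_z$, $X_2=\partial_y+\frac x2\partial_z$ are orthonormal. Let $\Sigma=\{z=0\}$, and let $\delta$ be the sub-Riemannian distance from $\Sigma$: $\delta(p)$ is the infimum of the lengths of the horizontal curves from points of $\Sigma$ to $p$. It is finite everywhere, and the following holds. (1) If $p=(0,0,z_p)$ lies on the $z$-axis, then $\delta(p)=\sqrt{2\pi|z_p|}$. (2) For every $\xi\in\mathbb R$ the equation $4\xi+y+(1+y^2)\arctan(y)=0$ has exactly one solution $y=y_0(\xi)\in\mathbb R$, and the function $y_0$ is smooth. If $p=(x_p,y_p,z_p)$ does not lie on the $z$-axis, then $$\delta(p)=r_p\,\frac{4\xi_p+y_0(\xi_p)}{\sqrt{1+y_0(\xi_p)^2}},\qquad r_p=\sqrt{x_p^2+y_p^2},\quad \xi_p=\frac{|z_p|}{r_p^2}.$$ (3) For $q=(x_0,y_0)\ne(0,0)$, $r_0=\sqrt{x_0^2+y_0^2}$ and $t\in\mathbb R$, let $E(t;q)$ be the point at time $t$ of the arc-length parametrized normal geodesic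 that starts at $(x_0,y_0,0)$ with initial covector $\frac2{r_0}dz$: $$E(t;q)=\tfrac12\Big(x_0(1+\cos\tfrac{2t}{r_0})-y_0\sin\tfrac{2t}{r_0},\ y_0(1+\cos\tfrac{2t}{r_0})+x_0\sin\tfrac{2t}{r_0},\ \tfrac{r_0^2}{4}\big(\tfrac{2t}{r_0}+\sin\tfrac{2t}{r_0}\big)\Big).$$ The cut locus of $\Sigma$, that is, the set of points $p$ such that $E(t;q)=E(t;q')=p$ for some $t\in\mathbb R$ and some $q\neq q'$ in $\mathbb R^2\setminus\{0\}$, is the $z$-axis minus the origin. The same set is obtained if one requires in addition that both geodesics realize the distance, i.e. $\delta(p)=|t|$. (4) The focal locus of $\Sigma$, that is, the set of points $E(t;q)$ such that $(t,q)$ is the first critical point of $E$ met along $E(\cdot;q)$ from time $0$ to time $t$ (the differential of $E$ is not onto at $(t,q)$, but is onto at $(ct,q)$ for $0\le c<1$), is the $z$-axis minus the origin. -/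

import Mathlib

open scoped ENNReal ContDiff

noncomputable section

namespace Heisenberg

/-- The underlying manifold `ℝ³` of the first Heisenberg group, with coordinates `(x, y, z)`. -/
abbrev Pt : Type := ℝ × ℝ × ℝ

/-- The vector field `X₁ = ∂_x - (y/2) ∂_z`. -/
def X₁ (p : Pt) : Pt := (1, 0, -(p.2.1 / 2))

/-- The vector field `X₂ = ∂_y + (x/2) ∂_z`. -/
def X₂ (p : Pt) : Pt := (0, 1, p.1 / 2)

/-- `γ` restricted to `[0, T]` is a horizontal curve with control `u`: it is absolutely continuous,
`u ∈ L²([0, T], ℝ²)`, and `γ' = u₁ X₁(γ) + u₂ X₂(γ)` almost everywhere on `[0, T]`. -/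
structure IsHorizontalCurve (T : ℝ) (γ : ℝ → Pt) (u : ℝ → ℝ × ℝ) : Prop where
  pos : 0 < T
  absolutelyContinuous : AbsolutelyContinuousOnInterval γ 0 T
  memLp : MeasureTheory.MemLp u 2 (MeasureTheory.volume.restrict (Set.Icc 0 T))
  hasDerivAt : ∀ᵐ t ∂(MeasureTheory.volume.restrict (Set.Icc 0 T)),
    HasDerivAt γ ((u t).1 • X₁ (γ t) + (u t).2 • X₂ (γ t)) t

/-- The sub-Riemannian length `∫₀ᵀ ‖γ'(t)‖_g dt` of a horizontal curve with control `u`. As `X₁`,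
`X₂` are orthonormal, `‖u₁ X₁ + u₂ X₂‖_g = √(u₁² + u₂²)`. -/
def curveLength (T : ℝ) (u : ℝ → ℝ × ℝ) : ℝ≥0∞ :=
  ∫⁻ t in Set.Icc 0 T, ENNReal.ofReal (Real.sqrt ((u t).1 ^ 2 + (u t).2 ^ 2))

/-- The sub-Riemannian distance: the infimum of the lengths of the horizontal curves between two
points (with value `⊤` if there were none). -/
def ccDist (p q : Pt) : ℝ≥0∞ :=
  ⨅ (T : ℝ) (γ : ℝ → Pt) (u : ℝ → ℝ × ℝ) (_ : IsHorizontalCurve T γ u) (_ : γ 0 = p)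
    (_ : γ T = q), curveLength T u

/-- The `xy`-plane `Σ = {z = 0}`. -/
def xyPlane : Set Pt := {p | p.2.2 = 0}

/-- The `z`-axis. -/
def zAxis : Set Pt := {p | p.1 = 0 ∧ p.2.1 = 0}

/-- The sub-Riemannian distance `δ` from the `xy`-plane. -/
def planeDist (p : Pt) : ℝ≥0∞ := ⨅ q ∈ xyPlane, ccDist q p

/-- The cylindrical coordinate `r_p = √(x² + y²)`. -/
def radius (p : Pt) : ℝ := Real.sqrt (p.1 ^ 2 + p.2.1 ^ 2)

/-- The cylindrical invariant `ξ_p = |z_p| / r_p²` (used only for `r_p ≠ 0`). -/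
def xi (p : Pt) : ℝ := |p.2.2| / radius p ^ 2

/-- `(γ, l)` is an integral curve of the Hamiltonian vector field of
`H = ((λ_x - (y/2) λ_z)² + (λ_y + (x/2) λ_z)²) / 2`, i.e. a normal extremal; `γ` is the position
and `l = (λ_x, λ_y, λ_z)` the covector. -/
structure IsNormalExtremal (γ l : ℝ → Pt) : Prop where
  x : ∀ t, HasDerivAt (fun s => (γ s).1) ((l t).1 - (γ t).2.1 / 2 * (l t).2.2) t
  y : ∀ t, HasDerivAt (fun s => (γ s).2.1) ((l t).2.1 + (γ t).1 / 2 * (l t).2.2) t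
  z : ∀ t, HasDerivAt (fun s => (γ s).2.2)
    (-((γ t).2.1 / 2) * ((l t).1 - (γ t).2.1 / 2 * (l t).2.2)
      + (γ t).1 / 2 * ((l t).2.1 + (γ t).1 / 2 * (l t).2.2)) t
  lx : ∀ t, HasDerivAt (fun s => (l s).1)
    (-((l t).2.2 / 2 * ((l t).2.1 + (γ t).1 / 2 * (l t).2.2))) t
  ly : ∀ t, HasDerivAt (fun s => (l s).2.1)
    ((l t).2.2 / 2 * ((l t).1 - (γ t).2.1 / 2 * (l t).2.2)) t
  lz : ∀ t, HasDerivAt (fun s => (l s).2.2) 0 t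

/-- The exponential map `E(t; x₀, y₀)` of the `xy`-plane: `t ↦ E(t; x₀, y₀)` is the arc-length
parametrized normal geodesic starting at `(x₀, y₀, 0)`, with `r₀ = √(x₀² + y₀²) ≠ 0`, with initial
covector `(2 / r₀) dz`, which annihilates the plane. Times `t < 0` give the geodesic with the
opposite initial covector, on the other side of the plane. -/
def planeExp (a : ℝ × (ℝ × ℝ)) : Pt :=
  let t := a.1
  let x₀ := a.2.1
  let y₀ := a.2.2
  let r₀ := Real.sqrt (x₀ ^ 2 + y₀ ^ 2)
  ((x₀ * (1 + Real.cos (2 * t / r₀)) - y₀ * Real.sin (2 * t / r₀)) / 2,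
   (y₀ * (1 + Real.cos (2 * t / r₀)) + x₀ * Real.sin (2 * t / r₀)) / 2,
   r₀ ^ 2 / 8 * (2 * t / r₀ + Real.sin (2 * t / r₀)))

/-- `planeExp` is the restriction of the sub-Riemannian exponential map to the unit covectors
annihilating the `xy`-plane. -/
theorem planeExp_isNormalExtremal (q : ℝ × ℝ) (hq : q ≠ 0) :
    ∃ l : ℝ → Pt, IsNormalExtremal (fun t => planeExp (t, q)) l ∧
      planeExp (0, q) = (q.1, q.2, 0) ∧
      l 0 = (0, 0, 2 / Real.sqrt (q.1 ^ 2 + q.2 ^ 2)) := by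
  obtain ⟨x, y⟩ := q
  have hpos : 0 < x ^ 2 + y ^ 2 := by
    by_contra h
    have hx : x = 0 := by nlinarith [sq_nonneg x, sq_nonneg y]
    have hy : y = 0 := by nlinarith [sq_nonneg x, sq_nonneg y]
    exact hq (by simp [hx, hy])
  obtain ⟨r, hr⟩ : ∃ r, Real.sqrt (x ^ 2 + y ^ 2) = r := ⟨_, rfl⟩
  have hr0 : r ≠ 0 := by rw [← hr]; exact (Real.sqrt_pos.2 hpos).ne'
  have hr2 : r ^ 2 = x ^ 2 + y ^ 2 := by rw [← hr]; exact Real.sq_sqrt hpos.le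
  have hθ : ∀ t : ℝ, HasDerivAt (fun s => 2 * s / r) (2 / r) t := fun t => by
    simpa using ((hasDerivAt_id t).const_mul 2).div_const r
  have hc := fun t => (hθ t).cos
  have hs := fun t => (hθ t).sin
  refine ⟨fun t => ((-x * Real.sin (2 * t / r) + y * (1 - Real.cos (2 * t / r))) / (2 * r),
    (-y * Real.sin (2 * t / r) - x * (1 - Real.cos (2 * t / r))) / (2 * r), 2 / r),
    ⟨?_, ?_, ?_, ?_, ?_, ?_⟩, ?_, ?_⟩
  · intro t
    simp only [planeExp, hr]
    refine (((((hc t).const_add 1).const_mul x).sub ((hs t).const_mul y)).div_const 2).congr_deriv ?_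
    field_simp
    ring
  · intro t
    simp only [planeExp, hr]
    refine (((((hc t).const_add 1).const_mul y).add ((hs t).const_mul x)).div_const 2).congr_deriv ?_
    field_simp
    ring
  · intro t
    simp only [planeExp, hr]
    refine (((hθ t).add (hs t)).const_mul (r ^ 2 / 8)).congr_deriv ?_
    have h1 := Real.sin_sq_add_cos_sq (2 * t / r)
    generalize Real.sin (2 * t / r) = S at h1 ⊢
    generalize Real.cos (2 * t / r) = C at h1 ⊢
    field_simp
    rw [hr2]
    linear_combination (-16 * (x ^ 2 + y ^ 2)) * h1
  · intro t
    simp only [planeExp, hr]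
    refine ((((hs t).const_mul (-x)).add
      (((hc t).const_sub 1).const_mul y)).div_const (2 * r)).congr_deriv ?_
    field_simp
    ring
  · intro t
    simp only [planeExp, hr]
    refine ((((hs t).const_mul (-y)).sub
      (((hc t).const_sub 1).const_mul x)).div_const (2 * r)).congr_deriv ?_
    field_simp
    ring
  · intro t
    exact hasDerivAt_const t _
  · simp only [planeExp, mul_zero, zero_div, Real.cos_zero, Real.sin_zero, Prod.mk.injEq]
    refine ⟨?_, ?_, ?_⟩ <;> ring
  · simp [hr]

/-- The cut locus of the `xy`-plane: the points `p` at which `E` fails to be injective, i.e.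
`E(t; q) = E(t; q') = p` for some time `t` and two distinct starting points `q`, `q'`. -/
def cutLocus : Set Pt :=
  {p | ∃ (t : ℝ) (q q' : ℝ × ℝ), q ≠ 0 ∧ q' ≠ 0 ∧ q ≠ q' ∧
    planeExp (t, q) = p ∧ planeExp (t, q') = p}

/-- The points joined to the `xy`-plane by two distinct normal geodesics `E(·; q)`, `E(·; q')` that
both realize the distance from the plane. -/
def minimizingCutLocus : Set Pt :=
  {p | ∃ (t : ℝ) (q q' : ℝ × ℝ), q ≠ 0 ∧ q' ≠ 0 ∧ q ≠ q' ∧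
    planeExp (t, q) = p ∧ planeExp (t, q') = p ∧ planeDist p = ENNReal.ofReal |t|}

/-- `(t, q)` is a critical point of `E`. -/
def IsCriticalPoint (a : ℝ × (ℝ × ℝ)) : Prop :=
  ¬ Function.Surjective (fderiv ℝ planeExp a)

/-- The focal locus of the `xy`-plane: the points `E(t; q)` such that `(t, q)` is the first critical
point of `E` along the geodesic `E(·; q)`, when it is followed from time `0` to time `t`. -/
def focalLocus : Set Pt :=
  {p | ∃ (t : ℝ) (q : ℝ × ℝ), q ≠ 0 ∧ planeExp (t, q) = p ∧ IsCriticalPoint (t, q) ∧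
    ∀ c : ℝ, 0 ≤ c → c < 1 → ¬ IsCriticalPoint (c * t, q)}

end Heisenberg

end

open scoped ENNReal ContDiff

noncomputable section

/-! The lower bound on the distance is a calibration. For `m = ± l` the quantity `s / 2 - m z + (l /
4) tan (l s / 2) r²`, with `s` the length already travelled, does not decrease along horizontal
curves as long as `l s < π`: its derivative is a sum of squares divided by twice the speed. It
vanishes on the plane at `s = 0`, so every curve of length `L` from the plane to `p` satisfies `m
z_p ≤ L / 2 + (l / 4) tan (l L / 2) r_p²` (`IsHorizontalCurve.calibration`). With `l` adapted to the
target this rules out `L` below the claimed distance (`le_planeDist`).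

The upper bound comes from the explicit geodesics. With the half angle `φ = t / r₀` and `ℝ² = ℂ`,
the horizontal part of `E(t; q)` is `cos φ e^{iφ} q` and its height is `(r₀ t + r₀² sin φ cos φ) /
4` (`planeExp_half`). Putting `w = tan φ` and solving for `q` gives the height equation, whose root
is `w = - y₀`. At `φ = ± π / 2` the factor `cos φ` collapses a whole circle to one point of the
axis.

Both loci come from that factor. Two geodesics meeting at the same time have equal half angles,
hence equal radii, so they coincide unless `cos φ = 0`. The differential of `E` is invertible for
`|φ| < π / 2` and degenerate when `cos φ = 0`. -/

/-! ### Absolutely continuous functions -/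

/-- A map whose increments are bounded by those of an absolutely continuous map is absolutely
continuous. -/
theorem AbsolutelyContinuousOnInterval.of_dist_le {X Y : Type*} [PseudoMetricSpace X]
    [PseudoMetricSpace Y] {f : ℝ → X} {g : ℝ → Y} {a b K : ℝ}
    (hf : AbsolutelyContinuousOnInterval f a b)
    (h : ∀ s ∈ Set.uIcc a b, ∀ t ∈ Set.uIcc a b, dist (g s) (g t) ≤ K * dist (f s) (f t)) :
    AbsolutelyContinuousOnInterval g a b := by
  have hlim := Filter.Tendsto.const_mul K hf
  rw [mul_zero] at hlim
  refine squeeze_zero' (Filter.Eventually.of_forall fun E => Finset.sum_nonneg fun _ _ =>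
    dist_nonneg) ?_ hlim
  filter_upwards [Filter.mem_inf_of_right (Filter.mem_principal_self _)] with E hE
  rw [Finset.mul_sum]
  exact Finset.sum_le_sum fun i hi => h _ (hE.1 i hi).1 _ (hE.1 i hi).2

/-- An absolutely continuous function with almost everywhere nonnegative derivative does not
decrease. -/
theorem AbsolutelyContinuousOnInterval.le_of_ae_hasDerivAt_nonneg {f : ℝ → ℝ} {a b : ℝ}
    (hab : a ≤ b) (hf : AbsolutelyContinuousOnInterval f a b)
    (h : ∀ᵐ t, t ∈ Set.Icc a b → ∃ f', 0 ≤ f' ∧ HasDerivAt f f' t) : f a ≤ f b := by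
  rw [← sub_nonneg, ← hf.integral_deriv_eq_sub]
  refine intervalIntegral.integral_nonneg_of_ae_restrict hab ?_
  rw [Filter.EventuallyLE, MeasureTheory.ae_restrict_iff' measurableSet_Icc]
  filter_upwards [h] with t ht hmem
  obtain ⟨f', h0, hd⟩ := ht hmem
  simpa [hd.deriv] using h0

namespace Heisenberg

open MeasureTheory

/-! ### Lower bound for the length: calibration -/

/-- The speed `√(u₁² + u₂²)` of a control. -/
def speed (v : ℝ × ℝ) : ℝ := Real.sqrt (v.1 ^ 2 + v.2 ^ 2)

theorem speed_nonneg (v : ℝ × ℝ) : 0 ≤ speed v := Real.sqrt_nonneg _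

theorem speed_sq (v : ℝ × ℝ) : speed v ^ 2 = v.1 ^ 2 + v.2 ^ 2 := Real.sq_sqrt (by positivity)

theorem continuous_speed : Continuous speed := by unfold speed; fun_prop

theorem speed_le (v : ℝ × ℝ) : speed v ≤ 2 * ‖v‖ := by
  have h1 := norm_fst_le v
  have h2 := norm_snd_le v
  rw [Real.norm_eq_abs] at h1 h2
  refine Real.sqrt_le_iff.2 ⟨by positivity, ?_⟩
  nlinarith [sq_abs v.1, sq_abs v.2, abs_nonneg v.1, abs_nonneg v.2]

theorem IsHorizontalCurve.integrable_speed {T : ℝ} {γ : ℝ → Pt} {u : ℝ → ℝ × ℝ}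
    (h : IsHorizontalCurve T γ u) :
    Integrable (fun t => speed (u t)) (volume.restrict (Set.Icc 0 T)) := by
  have hu : Integrable u (volume.restrict (Set.Icc 0 T)) :=
    h.memLp.integrable (by norm_num)
  refine (hu.norm.const_mul 2).mono
    (continuous_speed.comp_aestronglyMeasurable hu.aestronglyMeasurable)
    (Filter.Eventually.of_forall fun t => ?_)
  rw [Real.norm_of_nonneg (speed_nonneg _), Real.norm_of_nonneg (by positivity)]
  exact speed_le _

theorem IsHorizontalCurve.curveLength_eq {T : ℝ} {γ : ℝ → Pt} {u : ℝ → ℝ × ℝ}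
    (h : IsHorizontalCurve T γ u) :
    curveLength T u = ENNReal.ofReal (∫ t in 0..T, speed (u t)) := by
  rw [intervalIntegral.integral_of_le h.pos.le, ← integral_Icc_eq_integral_Ioc,
    ofReal_integral_eq_lintegral_ofReal h.integrable_speed
      (Filter.Eventually.of_forall fun t => speed_nonneg _)]
  rfl

/-- The pointwise inequality behind the calibration: the derivative of
`s / 2 - m z + (l / 4) tan (l s / 2) r²`, where `m = ± l`, along a horizontal curve is nonnegative. -/
theorem calibration_deriv_nonneg (x y a b c l m τ : ℝ) (hc : 0 ≤ c) (h : c ^ 2 = a ^ 2 + b ^ 2)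
    (hm : m ^ 2 = l ^ 2) :
    0 ≤ c / 2 - m * (x * b - y * a) / 2 +
      (l / 4 * ((1 + τ ^ 2) * (l / 2 * c)) * (x ^ 2 + y ^ 2) +
        l / 4 * τ * (2 * x * a + 2 * y * b)) := by
  rcases hc.eq_or_lt with rfl | hc
  · have ha : a = 0 := by nlinarith [sq_nonneg a, sq_nonneg b]
    have hb : b = 0 := by nlinarith [sq_nonneg a, sq_nonneg b]
    simp [ha, hb]
  · refine nonneg_of_mul_nonneg_left (b := c) ?_ hc
    -- Twice the expression times the speed `c` is this sum of two squares; the cross terms in `x y`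
    -- cancel.
    have h1 := add_nonneg (sq_nonneg (a + m * c / 2 * y + l * τ * c / 2 * x))
      (sq_nonneg (b - m * c / 2 * x + l * τ * c / 2 * y))
    linear_combination h1 / 2 - h / 2 + (c ^ 2 * (x ^ 2 + y ^ 2) / 8) * hm

/-- The calibration inequality: for a horizontal curve of length `L` from the `xy`-plane to `p` and
`m = ± l` with `0 ≤ l` and `l L < π`, one has `m z_p ≤ L / 2 + (l / 4) tan (l L / 2) r_p²`. -/
theorem IsHorizontalCurve.calibration {T : ℝ} {γ : ℝ → Pt} {u : ℝ → ℝ × ℝ}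
    (h : IsHorizontalCurve T γ u) (h0 : (γ 0).2.2 = 0) {l m : ℝ} (hl : 0 ≤ l) (hm : m ^ 2 = l ^ 2)
    (hlL : l * (∫ t in 0..T, speed (u t)) < Real.pi) :
    m * (γ T).2.2 ≤ (∫ t in 0..T, speed (u t)) / 2 +
      l / 4 * Real.tan (l / 2 * (∫ t in 0..T, speed (u t))) *
        ((γ T).1 ^ 2 + (γ T).2.1 ^ 2) := by
  have hT := h.pos.le
  have hii : IntervalIntegrable (fun t => speed (u t)) volume 0 T := by
    rw [intervalIntegrable_iff_integrableOn_Icc_of_le hT]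
    exact h.integrable_speed
  set s : ℝ → ℝ := fun t => ∫ v in 0..t, speed (u v) with hs
  set L := ∫ t in 0..T, speed (u t) with hL
  have hsT : s T = L := rfl
  have hs_mem : ∀ t ∈ Set.Icc 0 T, s t ∈ Set.Icc 0 L := fun t ht =>
    ⟨intervalIntegral.integral_nonneg ht.1 fun _ _ => speed_nonneg _,
      intervalIntegral.integral_mono_interval le_rfl ht.1 ht.2
        (Filter.Eventually.of_forall fun _ => speed_nonneg _) hii⟩
  have hcos : ∀ v ∈ Set.Icc 0 L, Real.cos (l / 2 * v) ≠ 0 := fun v hv => by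
    have h1 : 0 ≤ l * v := mul_nonneg hl hv.1
    have h2 : l * v ≤ l * L := mul_le_mul_of_nonneg_left hv.2 hl
    exact (Real.cos_pos_of_mem_Ioo ⟨by linarith [Real.pi_pos], by linarith⟩).ne'
  have hs_ac : AbsolutelyContinuousOnInterval s 0 T :=
    hii.absolutelyContinuousOnInterval_intervalIntegral (by simp)
  -- The bound `l L < π` keeps the argument of `tan` below `π / 2`, so `tan` is Lipschitz on the
  -- range of `s` and the composition stays absolutely continuous.
  have htan_ac : AbsolutelyContinuousOnInterval (fun t => Real.tan (l / 2 * s t)) 0 T := by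
    have hd : ContDiffOn ℝ 1 (fun v => Real.tan (l / 2 * v)) (Set.Icc 0 L) := fun v hv =>
      ((Real.contDiffAt_tan.2 (hcos v hv)).comp v
        (contDiff_const.mul contDiff_id).contDiffAt).contDiffWithinAt
    obtain ⟨K, hK⟩ := hd.exists_lipschitzOnWith (by decide) (convex_Icc _ _) isCompact_Icc
    refine hs_ac.of_dist_le (K := K) fun a ha b hb => ?_
    rw [Set.uIcc_of_le hT] at ha hb
    exact hK.dist_le_mul _ (hs_mem a ha) _ (hs_mem b hb)
  have hx_ac : AbsolutelyContinuousOnInterval (fun t => (γ t).1) 0 T :=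
    h.absolutelyContinuous.of_dist_le (K := 1) fun a _ b _ => by
      rw [one_mul, Prod.dist_eq]; exact le_max_left _ _
  have hy_ac : AbsolutelyContinuousOnInterval (fun t => (γ t).2.1) 0 T :=
    h.absolutelyContinuous.of_dist_le (K := 1) fun a _ b _ => by
      rw [one_mul, Prod.dist_eq, Prod.dist_eq]
      exact (le_max_left _ _).trans (le_max_right _ _)
  have hz_ac : AbsolutelyContinuousOnInterval (fun t => (γ t).2.2) 0 T :=
    h.absolutelyContinuous.of_dist_le (K := 1) fun a _ b _ => by
      rw [one_mul, Prod.dist_eq, Prod.dist_eq]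
      exact (le_max_right _ _).trans (le_max_right _ _)
  have hG_ac : AbsolutelyContinuousOnInterval (fun t => (1 / 2 * s t - m * (γ t).2.2) +
      l / 4 * Real.tan (l / 2 * s t) * ((γ t).1 * (γ t).1 + (γ t).2.1 * (γ t).2.1)) 0 T :=
    ((hs_ac.const_mul _).sub (hz_ac.const_mul _)).add
      ((htan_ac.const_mul _).mul ((hx_ac.mul hx_ac).add (hy_ac.mul hy_ac)))
  have key := hG_ac.le_of_ae_hasDerivAt_nonneg hT (by
    have hd := h.hasDerivAt
    rw [ae_restrict_iff' measurableSet_Icc] at hd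
    filter_upwards [hd, hii.ae_hasDerivAt_integral] with t ht hst hmem
    have hst := hst (by rwa [Set.uIcc_of_le hT]) 0 (by simp)
    have hγ := ht hmem
    have hx : HasDerivAt (fun t => (γ t).1) _ t := hasFDerivAt_fst.comp_hasDerivAt t hγ
    have hyz := (hasFDerivAt_snd (p := γ t)).comp_hasDerivAt t hγ
    have hy : HasDerivAt (fun t => (γ t).2.1) _ t := hasFDerivAt_fst.comp_hasDerivAt t hyz
    have hz : HasDerivAt (fun t => (γ t).2.2) _ t := hasFDerivAt_snd.comp_hasDerivAt t hyz
    have htan := (Real.hasDerivAt_tan (hcos _ (hs_mem t hmem))).comp t (hst.const_mul (l / 2))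
    refine ⟨_, ?_, ((hst.const_mul (1 / 2)).sub (hz.const_mul m)).add
      ((htan.const_mul (l / 4)).mul ((hx.mul hx).add (hy.mul hy)))⟩
    have hsec : 1 / Real.cos (l / 2 * s t) ^ 2 = 1 + Real.tan (l / 2 * s t) ^ 2 := by
      rw [← Real.inv_one_add_tan_sq (hcos _ (hs_mem t hmem)), one_div, inv_inv]
    refine (calibration_deriv_nonneg (γ t).1 (γ t).2.1 (u t).1 (u t).2 (speed (u t)) l m
      (Real.tan (l / 2 * s t)) (speed_nonneg _) (speed_sq _) hm).trans_eq ?_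
    simp only [X₁, X₂, hsec, ContinuousLinearMap.coe_fst', ContinuousLinearMap.coe_snd',
      Prod.fst_add, Prod.snd_add, Prod.smul_fst, Prod.smul_snd, smul_eq_mul, Function.comp]
    ring)
  -- At time `0` the calibrating function is `0` wherever the curve starts in the plane, because
  -- `tan 0 = 0` kills the `r²` term.
  have hs0 : s 0 = 0 := intervalIntegral.integral_same
  simp only [hs0, hsT, h0, mul_zero, Real.tan_zero, zero_mul, sub_zero, add_zero] at key
  linarith

/-- A curve of length `L < D` would violate the calibration inequality for `m = l` or `m = -l`,
according to the sign of the height. The parameter `l` may depend on `L`. -/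
theorem le_planeDist {p : Pt} {D : ℝ}
    (h : ∀ L, 0 ≤ L → L < D → ∃ l, 0 ≤ l ∧ l * L < Real.pi ∧
      L / 2 + l / 4 * Real.tan (l / 2 * L) * (p.1 ^ 2 + p.2.1 ^ 2) < l * |p.2.2|) :
    ENNReal.ofReal D ≤ planeDist p := by
  simp only [planeDist, ccDist, le_iInf_iff]
  intro q hq T γ u hγ h0 hT
  rw [hγ.curveLength_eq]
  refine ENNReal.ofReal_le_ofReal (not_lt.1 fun hlt => ?_)
  obtain ⟨l, hl, hlL, hlt'⟩ := h _
    (intervalIntegral.integral_nonneg hγ.pos.le fun _ _ => speed_nonneg _) hlt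
  have hz : (γ 0).2.2 = 0 := by rw [h0]; exact hq
  subst hT
  have h1 := hγ.calibration hz hl rfl hlL
  have h2 := hγ.calibration hz hl (neg_sq l) hlL
  rcases abs_cases (γ T).2.2 with ⟨ha, _⟩ | ⟨ha, _⟩ <;> rw [ha] at hlt' <;> linarith

/-! ### Upper bound: the geodesics as horizontal curves -/

/-- The control of the geodesic `planeExp (·, q)`. -/
def expControl (q : ℝ × ℝ) (t : ℝ) : ℝ × ℝ :=
  ((-q.1 * Real.sin (2 * t / speed q) - q.2 * Real.cos (2 * t / speed q)) / speed q,
    (-q.2 * Real.sin (2 * t / speed q) + q.1 * Real.cos (2 * t / speed q)) / speed q)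

theorem planeExp_eq (t : ℝ) (q : ℝ × ℝ) : planeExp (t, q) =
    ((q.1 * (1 + Real.cos (2 * t / speed q)) - q.2 * Real.sin (2 * t / speed q)) / 2,
      (q.2 * (1 + Real.cos (2 * t / speed q)) + q.1 * Real.sin (2 * t / speed q)) / 2,
      speed q ^ 2 / 8 * (2 * t / speed q + Real.sin (2 * t / speed q))) := rfl

theorem speed_pos {q : ℝ × ℝ} (hq : q ≠ 0) : 0 < speed q := by
  refine (speed_nonneg q).lt_of_ne fun h => hq ?_
  have h1 := speed_sq q
  rw [← h] at h1
  ext <;> simp <;> nlinarith [sq_nonneg q.1, sq_nonneg q.2]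

theorem ne_zero_of_speed_pos {q : ℝ × ℝ} (h : 0 < speed q) : q ≠ 0 := by
  rintro rfl
  simp [speed] at h

theorem speed_expControl {q : ℝ × ℝ} (hq : q ≠ 0) (t : ℝ) : speed (expControl q t) = 1 := by
  have h0 := (speed_pos hq).ne'
  have h1 := Real.sin_sq_add_cos_sq (2 * t / speed q)
  have h2 := speed_sq q
  rw [speed, Real.sqrt_eq_one]
  simp only [expControl]
  generalize Real.sin (2 * t / speed q) = S at *
  generalize Real.cos (2 * t / speed q) = C at *
  field_simp
  rw [h2]
  linear_combination (q.1 ^ 2 + q.2 ^ 2) * h1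

theorem hasDerivAt_planeExp {q : ℝ × ℝ} (hq : q ≠ 0) (t : ℝ) :
    HasDerivAt (fun s => planeExp (s, q)) ((expControl q t).1 • X₁ (planeExp (t, q)) +
      (expControl q t).2 • X₂ (planeExp (t, q))) t := by
  have h0 := (speed_pos hq).ne'
  have h1 := Real.sin_sq_add_cos_sq (2 * t / speed q)
  have h2 := speed_sq q
  have hθ : HasDerivAt (fun s => 2 * s / speed q) (2 / speed q) t := by
    simpa using ((hasDerivAt_id t).const_mul 2).div_const (speed q)
  have hx := (((hθ.cos.const_add 1).const_mul q.1).sub (hθ.sin.const_mul q.2)).div_const 2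
  have hy := (((hθ.cos.const_add 1).const_mul q.2).add (hθ.sin.const_mul q.1)).div_const 2
  have hz := (hθ.add hθ.sin).const_mul (speed q ^ 2 / 8)
  refine (hx.prodMk (hy.prodMk hz)).congr_deriv ?_
  simp only [planeExp_eq, expControl, X₁, X₂, Prod.smul_mk, Prod.mk_add_mk, smul_eq_mul,
    Prod.mk.injEq]
  generalize Real.sin (2 * t / speed q) = S at *
  generalize Real.cos (2 * t / speed q) = C at *
  refine ⟨by field_simp; ring, by field_simp; ring, ?_⟩
  field_simp
  linear_combination (8 * (1 + C)) * h2 - 8 * (q.1 ^ 2 + q.2 ^ 2) * h1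

/-- Rescaling to `[0, 1]` treats `t > 0`, `t < 0` and `t = 0` alike, although a horizontal curve
needs an interval of positive length. -/
theorem isHorizontalCurve_planeExp {q : ℝ × ℝ} (hq : q ≠ 0) (t : ℝ) :
    IsHorizontalCurve 1 (fun s => planeExp (s * t, q)) (fun s => t • expControl q (s * t)) where
  pos := one_pos
  absolutelyContinuous := by
    refine ContDiffOn.absolutelyContinuousOnInterval (ContDiff.contDiffOn ?_)
    simp only [planeExp_eq]
    fun_prop
  memLp := by
    have hc : Continuous fun s => t • expControl q (s * t) := by
      unfold expControl
      fun_prop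
    obtain ⟨C, hC⟩ := isCompact_Icc.exists_bound_of_continuousOn (s := Set.Icc (0 : ℝ) 1)
      hc.continuousOn
    refine MemLp.of_bound hc.aestronglyMeasurable C ?_
    rw [ae_restrict_iff' measurableSet_Icc]
    exact Filter.Eventually.of_forall hC
  hasDerivAt := Filter.Eventually.of_forall fun s => by
    have h := (hasDerivAt_planeExp hq (s * t)).scomp s ((hasDerivAt_id s).mul_const t)
    refine h.congr_deriv ?_
    simp only [Prod.smul_fst, Prod.smul_snd, smul_eq_mul, one_mul, smul_add, smul_smul]

theorem planeDist_planeExp_le {q : ℝ × ℝ} (hq : q ≠ 0) (t : ℝ) :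
    planeDist (planeExp (t, q)) ≤ ENNReal.ofReal |t| := by
  have hc := isHorizontalCurve_planeExp hq t
  have hlen : curveLength 1 (fun s => t • expControl q (s * t)) = ENNReal.ofReal |t| := by
    have hs : ∀ s, speed (t • expControl q (s * t)) = |t| := fun s => by
      have h := speed_expControl hq (s * t)
      have h' := speed_sq (expControl q (s * t))
      rw [h] at h'
      rw [speed, ← Real.sqrt_sq_eq_abs]
      simp only [Prod.smul_fst, Prod.smul_snd, smul_eq_mul]
      congr 1
      linear_combination -t ^ 2 * h'
    rw [hc.curveLength_eq]
    simp [hs]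
  have h0 : planeExp (0, q) ∈ xyPlane := by simp [xyPlane, planeExp]
  rw [← hlen]
  refine (iInf₂_le _ h0).trans ?_
  refine iInf_le_of_le 1 (iInf_le_of_le _ (iInf_le_of_le _ (iInf_le_of_le hc ?_)))
  exact iInf_le_of_le (by simp) (iInf_le_of_le (by simp) le_rfl)

/-! ### The function `y₀` -/

theorem mul_arctan_nonneg (y : ℝ) : 0 ≤ y * Real.arctan y := by
  rcases le_total 0 y with h | h
  · exact mul_nonneg h (Real.arctan_nonneg.2 h)
  · exact mul_nonneg_of_nonpos_of_nonpos h (by simpa using Real.arctan_mono h)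

/-- The function `y + (1 + y²) arctan y`, whose inverse yields `y₀`. -/
def heightFun (y : ℝ) : ℝ := y + (1 + y ^ 2) * Real.arctan y

theorem hasDerivAt_heightFun (y : ℝ) :
    HasDerivAt heightFun (2 + 2 * (y * Real.arctan y)) y := by
  refine ((hasDerivAt_id y).add ((((hasDerivAt_id y).pow 2).const_add 1).mul
    (Real.hasDerivAt_arctan y))).congr_deriv ?_
  have : (1 + y ^ 2) ≠ 0 := by positivity
  simp only [id, Nat.cast_ofNat, Nat.add_one_sub_one, pow_one, mul_one, one_div,
    Pi.pow_apply, mul_inv_cancel₀ this]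
  ring

theorem strictMono_heightFun : StrictMono heightFun :=
  strictMono_of_hasDerivAt_pos hasDerivAt_heightFun fun y => by
    linarith [mul_arctan_nonneg y]

theorem surjective_heightFun : Function.Surjective heightFun := by
  refine Continuous.surjective
    (continuous_iff_continuousAt.2 fun y => (hasDerivAt_heightFun y).continuousAt)
    (Filter.tendsto_atTop_mono' _ ?_ Filter.tendsto_id)
    (Filter.tendsto_atBot_mono' _ ?_ Filter.tendsto_id)
  · filter_upwards [Filter.eventually_ge_atTop 0] with y hy
    have : 0 ≤ (1 + y ^ 2) * Real.arctan y := mul_nonneg (by positivity) (Real.arctan_nonneg.2 hy)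
    simpa [heightFun] using this
  · filter_upwards [Filter.eventually_le_atBot 0] with y hy
    have : (1 + y ^ 2) * Real.arctan y ≤ 0 :=
      mul_nonpos_of_nonneg_of_nonpos (by positivity) (by simpa using Real.arctan_mono hy)
    simpa [heightFun] using this

theorem contDiff_heightFun : ContDiff ℝ ∞ heightFun :=
  contDiff_id.add ((contDiff_const.add (contDiff_id.pow 2)).mul Real.contDiff_arctan)

/-- `heightFun` as a homeomorphism of the line. -/
def heightHomeomorph : ℝ ≃ₜ ℝ :=
  (strictMono_heightFun.orderIsoOfSurjective _ surjective_heightFun).toHomeomorph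

theorem heightHomeomorph_apply (y : ℝ) : heightHomeomorph y = heightFun y := rfl

/-- The solution `y₀(ξ)` of `4 ξ + y + (1 + y²) arctan y = 0`. -/
def heightRoot (ξ : ℝ) : ℝ := heightHomeomorph.symm (-(4 * ξ))

/-- The derivative `2 + 2 y arctan y` of `heightFun` is at least `2`, so the inverse is smooth. -/
theorem contDiff_heightRoot : ContDiff ℝ ∞ heightRoot :=
  (heightHomeomorph.contDiff_symm_deriv (n := ∞)
    (fun y => by linarith [mul_arctan_nonneg y] : ∀ y, 2 + 2 * (y * Real.arctan y) ≠ 0)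
    hasDerivAt_heightFun contDiff_heightFun).comp (contDiff_const.mul contDiff_id).neg

theorem eq_heightRoot_iff (ξ y : ℝ) :
    4 * ξ + y + (1 + y ^ 2) * Real.arctan y = 0 ↔ y = heightRoot ξ := by
  rw [heightRoot, ← heightHomeomorph.symm_apply_apply y,
    heightHomeomorph.symm.injective.eq_iff, heightHomeomorph.symm_apply_apply,
    heightHomeomorph_apply, heightFun]
  constructor <;> intro h <;> linarith

/-! ### The distance from the plane -/

/-- Here `w = tan φ`. Since `cos φ e^{iφ} = 1 / (1 - i w)`, the starting point is `(1 - i w)` times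
the horizontal part of `p`, of modulus `r_p √(1 + w²)`; the hypothesis is the height of `E` written
in `w`. -/
theorem planeExp_of_tan {p : Pt} (hr : 0 < radius p) {w : ℝ}
    (hw : 4 * p.2.2 = radius p ^ 2 * (w + (1 + w ^ 2) * Real.arctan w)) :
    planeExp (radius p * Real.sqrt (1 + w ^ 2) * Real.arctan w,
      (p.1 + w * p.2.1, p.2.1 - w * p.1)) = p := by
  have hS : 0 < Real.sqrt (1 + w ^ 2) := Real.sqrt_pos.2 (by positivity)
  have hr2 : radius p ^ 2 = p.1 ^ 2 + p.2.1 ^ 2 := Real.sq_sqrt (by positivity)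
  have hq : speed (p.1 + w * p.2.1, p.2.1 - w * p.1) = radius p * Real.sqrt (1 + w ^ 2) := by
    rw [radius, ← Real.sqrt_mul (by positivity), speed]
    congr 1
    ring
  have hang : 2 * (radius p * Real.sqrt (1 + w ^ 2) * Real.arctan w) /
      (radius p * Real.sqrt (1 + w ^ 2)) = 2 * Real.arctan w := by
    field_simp
  have hcos : Real.cos (2 * Real.arctan w) = (1 - w ^ 2) / (1 + w ^ 2) := by
    rw [Real.cos_two_mul, Real.cos_sq_arctan]
    field_simp
    ring
  have hsin : Real.sin (2 * Real.arctan w) = 2 * w / (1 + w ^ 2) := by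
    rw [Real.sin_two_mul, Real.sin_arctan, Real.cos_arctan]
    field_simp
    rw [Real.sq_sqrt (by positivity)]
  rw [planeExp_eq, hq, hang, hcos, hsin, mul_pow, Real.sq_sqrt (by positivity)]
  refine Prod.ext ?_ (Prod.ext ?_ ?_)
  · field_simp
    ring
  · field_simp
    ring
  · simp only
    field_simp
    linear_combination -2 * hw

theorem planeDist_of_tan {p : Pt} (hr : 0 < radius p) {w : ℝ} (hw0 : 0 ≤ w)
    (hw : 4 * |p.2.2| = radius p ^ 2 * (w + (1 + w ^ 2) * Real.arctan w)) :
    planeDist p = ENNReal.ofReal (radius p * Real.sqrt (1 + w ^ 2) * Real.arctan w) := by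
  have hS : 0 < Real.sqrt (1 + w ^ 2) := Real.sqrt_pos.2 (by positivity)
  have hS2 : Real.sqrt (1 + w ^ 2) ^ 2 = 1 + w ^ 2 := Real.sq_sqrt (by positivity)
  have hr2 : radius p ^ 2 = p.1 ^ 2 + p.2.1 ^ 2 := Real.sq_sqrt (by positivity)
  have hat : 0 ≤ Real.arctan w := Real.arctan_nonneg.2 hw0
  refine le_antisymm ?_ (le_planeDist fun L hL0 hL => ?_)
  · have key : ∀ v : ℝ,
        4 * p.2.2 = radius p ^ 2 * (v + (1 + v ^ 2) * Real.arctan v) →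
        planeDist p ≤ ENNReal.ofReal |radius p * Real.sqrt (1 + v ^ 2) * Real.arctan v| := by
      intro v hv
      have hq : ((p.1 + v * p.2.1, p.2.1 - v * p.1) : ℝ × ℝ) ≠ 0 := fun h => by
        have h1 : p.1 + v * p.2.1 = 0 := congrArg Prod.fst h
        have h2 : p.2.1 - v * p.1 = 0 := congrArg Prod.snd h
        have h3 : (1 + v ^ 2) * radius p ^ 2 = 0 := by
          rw [hr2]
          linear_combination (p.1 + v * p.2.1) * h1 + (p.2.1 - v * p.1) * h2
        have : 0 < (1 + v ^ 2) * radius p ^ 2 := by positivity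
        linarith
      have := planeDist_planeExp_le hq (radius p * Real.sqrt (1 + v ^ 2) * Real.arctan v)
      rwa [planeExp_of_tan hr hv] at this
    rcases abs_cases p.2.2 with ⟨ha, _⟩ | ⟨ha, _⟩
    · refine (key w (by rw [← ha, hw])).trans_eq ?_
      rw [abs_of_nonneg (by positivity)]
    · refine (key (-w)
        (by rw [Real.arctan_neg]; linear_combination 4 * ha - hw)).trans_eq ?_
      rw [Real.arctan_neg, neg_sq, mul_neg, abs_neg, abs_of_nonneg (by positivity)]
  · set S := Real.sqrt (1 + w ^ 2)
    -- For `w = 0` the claimed distance is `0` and no `L` has to be excluded.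
    have hat' : 0 < Real.arctan w := pos_of_mul_pos_right (hL0.trans_lt hL) (by positivity)
    have hang : 2 / (radius p * S) / 2 * L < Real.arctan w := by
      rw [show 2 / (radius p * S) / 2 * L = L / (radius p * S) by field_simp,
        div_lt_iff₀ (by positivity)]
      linarith
    have hpi := Real.arctan_lt_pi_div_two w
    have hnn : 0 ≤ 2 / (radius p * S) / 2 * L := by positivity
    -- This `l` is the initial covector `2 / r₀` of the geodesic reaching `p`. The calibration
    -- inequality becomes an equality at `L = D` (`h2` below), hence fails for smaller `L`.
    refine ⟨2 / (radius p * S), by positivity, by linarith, ?_⟩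
    have htan : Real.tan (2 / (radius p * S) / 2 * L) ≤ w := by
      conv_rhs => rw [← Real.tan_arctan w]
      exact (Real.tan_lt_tan_of_lt_of_lt_pi_div_two (by linarith) hpi hang).le
    have h1 : 2 / (radius p * S) / 4 * Real.tan (2 / (radius p * S) / 2 * L) *
        (p.1 ^ 2 + p.2.1 ^ 2) ≤ 2 / (radius p * S) / 4 * w * (p.1 ^ 2 + p.2.1 ^ 2) := by
      gcongr
    have h2 : 2 / (radius p * S) * |p.2.2| =
        radius p * S * Real.arctan w / 2 + 2 / (radius p * S) / 4 * w * radius p ^ 2 := by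
      field_simp
      linear_combination 4 * hw - 4 * radius p ^ 2 * Real.arctan w * hS2
    rw [h2, hr2]
    linarith

theorem abs_sign {σ : ℝ} (hσ : σ = 1 ∨ σ = -1) : |σ| = 1 := by
  rcases hσ with rfl | rfl <;> simp

theorem planeExp_quarter {q : ℝ × ℝ} (hq : q ≠ 0) {σ : ℝ} (hσ : σ = 1 ∨ σ = -1) :
    planeExp (σ * (speed q * Real.pi / 2), q) = (0, 0, σ * (speed q ^ 2 * Real.pi / 8)) := by
  have h0 := (speed_pos hq).ne'
  have hang : 2 * (σ * (speed q * Real.pi / 2)) / speed q = σ * Real.pi := by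
    field_simp
  rw [planeExp_eq, hang]
  rcases hσ with rfl | rfl <;> simp <;> ring

theorem exists_sign_mul_abs (z : ℝ) : ∃ σ : ℝ, (σ = 1 ∨ σ = -1) ∧ σ * |z| = z := by
  rcases abs_cases z with ⟨h, _⟩ | ⟨h, _⟩
  · exact ⟨1, Or.inl rfl, by linarith⟩
  · exact ⟨-1, Or.inr rfl, by linarith⟩

/-- Every point `(0, 0, z)` with `z ≠ 0` is reached, after a quarter turn, by the geodesics from all
the points of a circle, at a time whose absolute value is `√(2π|z|)`. -/
theorem exists_planeExp_eq_axis {z : ℝ} (hz : z ≠ 0) : ∃ r σ : ℝ, 0 < r ∧ (σ = 1 ∨ σ = -1) ∧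
    |σ * (r * Real.pi / 2)| = Real.sqrt (2 * Real.pi * |z|) ∧
    ∀ q : ℝ × ℝ, speed q = r → planeExp (σ * (r * Real.pi / 2), q) = (0, 0, z) := by
  have hpi := Real.pi_pos
  have hz' := abs_pos.2 hz
  obtain ⟨σ, hσ, hσz⟩ : ∃ σ : ℝ, (σ = 1 ∨ σ = -1) ∧ σ * |z| = z := exists_sign_mul_abs z
  have hD : 0 < Real.sqrt (2 * Real.pi * |z|) := Real.sqrt_pos.2 (by positivity)
  have hD2 : Real.sqrt (2 * Real.pi * |z|) ^ 2 = 2 * Real.pi * |z| := Real.sq_sqrt (by positivity)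
  set D := Real.sqrt (2 * Real.pi * |z|)
  -- The radius is chosen so that the time `r π / 2` of the quarter turn is `D`.
  refine ⟨2 * D / Real.pi, σ, by positivity, hσ, ?_, fun q hq => ?_⟩
  · rw [abs_mul, abs_sign hσ, one_mul,
      abs_of_pos (by positivity)]
    field_simp
  · have hq0 : q ≠ 0 := ne_zero_of_speed_pos (hq.symm ▸ by positivity)
    have h := planeExp_quarter hq0 hσ
    rw [hq] at h
    rw [h]
    refine Prod.ext rfl (Prod.ext rfl ?_)
    change σ * ((2 * D / Real.pi) ^ 2 * Real.pi / 8) = z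
    rw [← hσz]
    field_simp
    linear_combination 4 * σ * hD2

theorem speed_axis {r : ℝ} (hr : 0 ≤ r) : speed (r, 0) = r := by
  simp [speed, Real.sqrt_sq hr]

theorem speed_neg_axis {r : ℝ} (hr : 0 ≤ r) : speed (-r, 0) = r := by
  simp [speed, Real.sqrt_sq hr]

/-- No geodesic `E(·; q)` passes through the origin, so a constant curve is used. -/
theorem planeDist_origin : planeDist 0 = 0 := by
  refine le_antisymm ?_ bot_le
  have hc : IsHorizontalCurve 1 (fun _ => (0 : Pt)) (fun _ => 0) :=
    ⟨one_pos, contDiff_const.contDiffOn.absolutelyContinuousOnInterval, MemLp.zero,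
      Filter.Eventually.of_forall fun t => by simpa using hasDerivAt_const t (0 : Pt)⟩
  refine (iInf₂_le (0 : Pt) (by simp [xyPlane])).trans ?_
  refine iInf_le_of_le 1 (iInf_le_of_le _ (iInf_le_of_le _ (iInf_le_of_le hc ?_)))
  exact iInf_le_of_le rfl (iInf_le_of_le rfl (by simp [curveLength]))

theorem planeDist_axis (z : ℝ) :
    planeDist (0, 0, z) = ENNReal.ofReal (Real.sqrt (2 * Real.pi * |z|)) := by
  rcases eq_or_ne z 0 with rfl | hz
  · rw [abs_zero, mul_zero, Real.sqrt_zero, ENNReal.ofReal_zero]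
    exact planeDist_origin
  have hpi := Real.pi_pos
  have hz' := abs_pos.2 hz
  set D := Real.sqrt (2 * Real.pi * |z|) with hD
  have hD2 : D ^ 2 = 2 * Real.pi * |z| := Real.sq_sqrt (by positivity)
  have hD0 : 0 < D := Real.sqrt_pos.2 (by positivity)
  refine le_antisymm ?_ (le_planeDist fun L hL0 hL => ?_)
  · obtain ⟨r, σ, hr, -, habs, hE⟩ := exists_planeExp_eq_axis hz
    have hs := speed_axis hr.le
    have h1 := planeDist_planeExp_le (ne_zero_of_speed_pos (hs.symm ▸ hr)) (σ * (r * Real.pi / 2))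
    rwa [hE _ hs, habs] at h1
  -- On the axis the `tan` term drops out, and `l = π / D` is admissible for every `L < D`, with `l
  -- |z| = D / 2`.
  · refine ⟨Real.pi / D, by positivity, ?_, ?_⟩
    · rw [div_mul_eq_mul_div, div_lt_iff₀ hD0]
      gcongr
    · have : Real.pi / D * |z| = D / 2 := by
        field_simp
        linarith
      simp only [this]
      linarith

/-! ### The cut locus -/

theorem planeExp_half {q : ℝ × ℝ} (hq : q ≠ 0) (t : ℝ) : planeExp (t, q) =
    (Real.cos (t / speed q) * (q.1 * Real.cos (t / speed q) - q.2 * Real.sin (t / speed q)),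
      Real.cos (t / speed q) * (q.2 * Real.cos (t / speed q) + q.1 * Real.sin (t / speed q)),
      (speed q * t + speed q ^ 2 * (Real.sin (t / speed q) * Real.cos (t / speed q))) / 4) := by
  have h0 := (speed_pos hq).ne'
  rw [planeExp_eq, show 2 * t / speed q = 2 * (t / speed q) by ring, Real.sin_two_mul,
    Real.cos_two_mul]
  refine Prod.ext ?_ (Prod.ext ?_ ?_)
  · simp only; ring
  · simp only; ring
  · simp only; field_simp; ring

theorem eq_zero_of_sin_eq {x ε : ℝ} (hε : ε = 1 ∨ ε = -1) (h : x = ε * Real.sin x) : x = 0 := by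
  by_contra hx
  have h1 := Real.abs_sin_lt_abs hx
  have h2 := congrArg abs h
  rw [abs_mul, abs_sign hε, one_mul] at h2
  linarith

/-- Two geodesics that meet at the same time have the same angle. -/
theorem angle_eq_of_planeExp_eq {q q' : ℝ × ℝ} (hq : q ≠ 0) (hq' : q' ≠ 0) {t : ℝ}
    (h : planeExp (t, q) = planeExp (t, q')) : t / speed q = t / speed q' := by
  have hr := speed_pos hq
  have hr' := speed_pos hq'
  have hr2 := speed_sq q
  have hr2' := speed_sq q'
  rw [planeExp_half hq, planeExp_half hq'] at h
  simp only [Prod.mk.injEq] at h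
  obtain ⟨h1, h2, h3⟩ := h
  have ht : speed q * (t / speed q) = t := by field_simp
  have ht' : speed q' * (t / speed q') = t := by field_simp
  have hsin := Real.sin_sub (t / speed q') (t / speed q)
  have hp := Real.sin_sq_add_cos_sq (t / speed q)
  have hp' := Real.sin_sq_add_cos_sq (t / speed q')
  generalize t / speed q = φ at *
  generalize t / speed q' = ψ at *
  generalize speed q = r at *
  generalize speed q' = r' at *
  -- Both sides are the squared distance of the common endpoint from the axis.
  have hsq : (r * Real.cos φ) ^ 2 = (r' * Real.cos ψ) ^ 2 := by
    have e1 : (r * Real.cos φ) ^ 2 =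
        (Real.cos φ * (q.1 * Real.cos φ - q.2 * Real.sin φ)) ^ 2 +
          (Real.cos φ * (q.2 * Real.cos φ + q.1 * Real.sin φ)) ^ 2 := by
      linear_combination Real.cos φ ^ 2 * hr2 - Real.cos φ ^ 2 * (q.1 ^ 2 + q.2 ^ 2) * hp
    have e2 : (r' * Real.cos ψ) ^ 2 =
        (Real.cos ψ * (q'.1 * Real.cos ψ - q'.2 * Real.sin ψ)) ^ 2 +
          (Real.cos ψ * (q'.2 * Real.cos ψ + q'.1 * Real.sin ψ)) ^ 2 := by
      linear_combination Real.cos ψ ^ 2 * hr2' - Real.cos ψ ^ 2 * (q'.1 ^ 2 + q'.2 ^ 2) * hp'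
    rw [e1, e2, h1, h2]
  obtain ⟨ε, hε, hc⟩ : ∃ ε : ℝ, (ε = 1 ∨ ε = -1) ∧ r * Real.cos φ = ε * (r' * Real.cos ψ) := by
    rcases sq_eq_sq_iff_eq_or_eq_neg.1 hsq with h | h
    · exact ⟨1, Or.inl rfl, by rw [h, one_mul]⟩
    · exact ⟨-1, Or.inr rfl, by rw [h, neg_one_mul]⟩
  have hεε : ε * ε = 1 := by rcases hε with rfl | rfl <;> norm_num
  -- From `t = r φ = r' ψ`, equal heights and `r cos φ = ± r' cos ψ` one gets `ψ - φ = ± sin (ψ -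
  -- φ)`.
  have key : ψ - φ = 0 := by
    refine eq_zero_of_sin_eq hε ?_
    rw [hsin]
    refine mul_left_cancel₀ (mul_pos hr hr').ne' ?_
    linear_combination r * ht' - r' * ht + 4 * h3 - (r * Real.sin φ + ε * r' * Real.sin ψ) * hc -
      r' ^ 2 * Real.cos ψ * Real.sin ψ * hεε
  linarith

theorem cutLocus_subset : cutLocus ⊆ zAxis \ {0} := by
  rintro p ⟨t, q, q', hq, hq', hne, h, h'⟩
  have hang := angle_eq_of_planeExp_eq hq hq' (h.trans h'.symm)
  have hr := speed_pos hq
  have hr' := speed_pos hq'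
  have ht : t ≠ 0 := by
    rintro rfl
    refine hne ?_
    rw [planeExp_half hq] at h
    rw [planeExp_half hq'] at h'
    have := h.trans h'.symm
    simp only [zero_div, Real.cos_zero, Real.sin_zero, Prod.mk.injEq] at this
    exact Prod.ext (by linarith [this.1]) (by linarith [this.2.1])
  have hspeed : speed q = speed q' := by
    rw [div_eq_div_iff hr.ne' hr'.ne'] at hang
    exact (mul_left_cancel₀ ht hang).symm
  rw [planeExp_half hq] at h
  rw [planeExp_half hq', ← hspeed] at h'
  have hp := Real.sin_sq_add_cos_sq (t / speed q)
  -- Otherwise `cos φ` cancels, and undoing the common rotation by `φ` gives `q = q'`.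
  have hcos : Real.cos (t / speed q) = 0 := by
    by_contra hC
    have := h.trans h'.symm
    simp only [Prod.mk.injEq, mul_right_inj' hC] at this
    obtain ⟨h1, h2, -⟩ := this
    generalize Real.sin (t / speed q) = S at *
    generalize Real.cos (t / speed q) = C at *
    exact hne (Prod.ext (by linear_combination C * h1 + S * h2 - (q.1 - q'.1) * hp)
      (by linear_combination C * h2 - S * h1 - (q.2 - q'.2) * hp))
  subst h
  simp only [hcos, zero_mul, mul_zero, add_zero]
  refine ⟨⟨rfl, rfl⟩, fun h0 => ?_⟩
  have : speed q * t / 4 = 0 := congrArg (fun p : Pt => p.2.2) h0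
  exact mul_ne_zero hr.ne' ht (by linarith)

theorem minimizingCutLocus_subset_cutLocus : minimizingCutLocus ⊆ cutLocus :=
  fun _ ⟨t, q, q', hq, hq', hne, h, h', _⟩ => ⟨t, q, q', hq, hq', hne, h, h'⟩

theorem eq_of_mem_zAxis {p : Pt} (hp : p ∈ zAxis) : p = (0, 0, p.2.2) :=
  Prod.ext hp.1 (Prod.ext hp.2 rfl)

theorem height_ne_zero {p : Pt} (hp : p ∈ zAxis \ {0}) : p.2.2 ≠ 0 := fun h =>
  hp.2 ((eq_of_mem_zAxis hp.1).trans (by rw [h]; rfl))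

theorem subset_minimizingCutLocus : zAxis \ {0} ⊆ minimizingCutLocus := by
  intro p hp
  obtain ⟨r, σ, hr, -, habs, hE⟩ := exists_planeExp_eq_axis (height_ne_zero hp)
  rw [eq_of_mem_zAxis hp.1]
  have h1 := speed_axis hr.le
  have h2 := speed_neg_axis hr.le
  refine ⟨_, (r, 0), (-r, 0), ne_zero_of_speed_pos (h1.symm ▸ hr),
    ne_zero_of_speed_pos (h2.symm ▸ hr), fun h => ?_, hE _ h1, hE _ h2, ?_⟩
  · have : r = -r := congrArg Prod.fst h
    linarith
  · rw [planeDist_axis, habs]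

theorem cutLocus_eq : cutLocus = zAxis \ {0} :=
  cutLocus_subset.antisymm (subset_minimizingCutLocus.trans minimizingCutLocus_subset_cutLocus)

theorem minimizingCutLocus_eq : minimizingCutLocus = zAxis \ {0} :=
  (minimizingCutLocus_subset_cutLocus.trans cutLocus_subset).antisymm subset_minimizingCutLocus

/-! ### The focal locus -/

theorem differentiableAt_planeExp {t : ℝ} {q : ℝ × ℝ} (hq : q ≠ 0) :
    DifferentiableAt ℝ planeExp (t, q) := by
  have h0 := speed_pos hq
  have hne : q.1 ^ 2 + q.2 ^ 2 ≠ 0 := (Real.sqrt_pos.1 h0).ne'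
  have hr : DifferentiableAt ℝ (fun a : ℝ × (ℝ × ℝ) => Real.sqrt (a.2.1 ^ 2 + a.2.2 ^ 2)) (t, q) :=
    DifferentiableAt.sqrt (by fun_prop) hne
  have hθ : DifferentiableAt ℝ
      (fun a : ℝ × (ℝ × ℝ) => 2 * a.1 / Real.sqrt (a.2.1 ^ 2 + a.2.2 ^ 2)) (t, q) :=
    DifferentiableAt.fun_mul (by fun_prop) (hr.inv h0.ne')
  unfold planeExp
  dsimp only
  fun_prop

/-- The differential of the exponential map, in terms of the half angle `φ = t / r₀`, the variation
`σ` of `r₀` and the variation `η` of `φ`. -/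
theorem fderiv_planeExp {t : ℝ} {q : ℝ × ℝ} (hq : q ≠ 0) (v : ℝ × (ℝ × ℝ)) :
    let C := Real.cos (t / speed q)
    let S := Real.sin (t / speed q)
    let σ := (q.1 * v.2.1 + q.2 * v.2.2) / speed q
    let η := (v.1 * speed q - t * σ) / speed q ^ 2
    fderiv ℝ planeExp (t, q) v =
      (C * (v.2.1 * C - v.2.2 * S) - η * (2 * q.1 * S * C + q.2 * (2 * C ^ 2 - 1)),
        C * (v.2.2 * C + v.2.1 * S) + η * (q.1 * (2 * C ^ 2 - 1) - 2 * q.2 * S * C),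
        (speed q * σ * (t / speed q + S * C) + speed q ^ 2 * η * C ^ 2) / 2) := by
  intro C S σ η
  have h0 := speed_pos hq
  -- Differentiability being known, the differential at `v` is found by differentiating along the
  -- line in direction `v`.
  have hline : HasDerivAt (fun s : ℝ => (t, q) + s • v) v 0 := by
    simpa using ((hasDerivAt_id (0 : ℝ)).smul_const v).const_add (t, q)
  have hE : HasFDerivAt planeExp (fderiv ℝ planeExp (t, q)) ((t, q) + (0 : ℝ) • v) := by
    rw [zero_smul, add_zero]
    exact (differentiableAt_planeExp hq).hasFDerivAt
  refine (hE.comp_hasDerivAt (0 : ℝ) hline).unique ?_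
  have lin : ∀ a b : ℝ, HasDerivAt (fun s : ℝ => a + s * b) b 0 := fun a b => by
    simpa using ((hasDerivAt_id (0 : ℝ)).mul_const b).const_add a
  have hx := lin q.1 v.2.1
  have hy := lin q.2 v.2.2
  have hr : HasDerivAt (fun s : ℝ => speed (q.1 + s * v.2.1, q.2 + s * v.2.2)) σ 0 := by
    refine (((hx.pow 2).add (hy.pow 2)).sqrt ?_).congr_deriv ?_
    · simpa using (Real.sqrt_pos.1 h0).ne'
    · simp only [σ, speed, zero_mul, add_zero, Pi.add_apply, Pi.pow_apply]
      field_simp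
      ring
  have hr0 : speed (q.1 + 0 * v.2.1, q.2 + 0 * v.2.2) = speed q := by simp
  have hθ : HasDerivAt (fun s : ℝ =>
      2 * (t + s * v.1) / speed (q.1 + s * v.2.1, q.2 + s * v.2.2)) (2 * η) 0 := by
    refine (((lin t v.1).const_mul 2).div hr (by rw [hr0]; exact h0.ne')).congr_deriv ?_
    rw [hr0]
    simp only [η]
    ring
  have h1 := ((hx.mul (hθ.cos.const_add 1)).sub (hy.mul hθ.sin)).div_const 2
  have h2 := ((hy.mul (hθ.cos.const_add 1)).add (hx.mul hθ.sin)).div_const 2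
  have h3 := ((hr.pow 2).div_const 8).mul (hθ.add hθ.sin)
  refine (h1.prodMk (h2.prodMk h3)).congr_deriv ?_
  have hang : 2 * (t + 0 * v.1) / speed q = 2 * (t / speed q) := by ring
  simp only [Pi.pow_apply, Pi.add_apply, hr0]
  simp only [hang]
  simp only [Real.sin_two_mul, Real.cos_two_mul, zero_mul, add_zero]
  refine Prod.ext ?_ (Prod.ext ?_ ?_)
  · simp only [C, S]; ring
  · simp only [C, S]; ring
  · simp only [C, S]; ring

/-- When `cos φ = 0` the horizontal part of the differential has only values orthogonal to `q`, so
`(q, 0)` is not attained. -/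
theorem isCriticalPoint_of_cos_eq_zero {t : ℝ} {q : ℝ × ℝ} (hq : q ≠ 0)
    (h : Real.cos (t / speed q) = 0) : IsCriticalPoint (t, q) := by
  intro hsurj
  obtain ⟨v, hv⟩ := hsurj (q.1, q.2, 0)
  rw [fderiv_planeExp hq, h] at hv
  simp only [Prod.mk.injEq] at hv
  obtain ⟨h1, h2, -⟩ := hv
  have hr := speed_pos hq
  have h3 : speed q ^ 2 = 0 := by
    rw [speed_sq]
    linear_combination -q.1 * h1 - q.2 * h2
  exact hr.ne' (pow_eq_zero_iff two_ne_zero |>.1 h3)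

theorem not_isCriticalPoint {t : ℝ} {q : ℝ × ℝ} (hq : q ≠ 0)
    (h : |t / speed q| < Real.pi / 2) : ¬ IsCriticalPoint (t, q) := by
  have hr := speed_pos hq
  have hr2 := speed_sq q
  obtain ⟨hlo, hhi⟩ := abs_lt.1 h
  have hC : 0 < Real.cos (t / speed q) := Real.cos_pos_of_mem_Ioo ⟨hlo, hhi⟩
  have hS : 0 ≤ t / speed q * Real.sin (t / speed q) := by
    rcases le_total 0 (t / speed q) with h0 | h0
    · exact mul_nonneg h0 (Real.sin_nonneg_of_nonneg_of_le_pi h0 (by linarith))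
    · exact mul_nonneg_of_nonpos_of_nonpos h0
        (Real.sin_nonpos_of_nonpos_of_neg_pi_le h0 (by linarith))
  rw [IsCriticalPoint, not_not]
  -- Equal dimensions: it suffices that the kernel is trivial.
  refine (LinearMap.injective_iff_surjective
    (f := (fderiv ℝ planeExp (t, q) : (ℝ × ℝ × ℝ) →ₗ[ℝ] (ℝ × ℝ × ℝ)))).1 ?_
  refine (injective_iff_map_eq_zero _).2 fun v hv => ?_
  have hp := Real.sin_sq_add_cos_sq (t / speed q)
  have hv : fderiv ℝ planeExp (t, q) v = 0 := hv
  rw [fderiv_planeExp hq, Prod.mk_eq_zero, Prod.mk_eq_zero] at hv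
  obtain ⟨h1, h2, h3⟩ := hv
  have hσ : speed q * ((q.1 * v.2.1 + q.2 * v.2.2) / speed q) = q.1 * v.2.1 + q.2 * v.2.2 := by
    field_simp
  set σ := (q.1 * v.2.1 + q.2 * v.2.2) / speed q
  have hη : speed q ^ 2 * ((v.1 * speed q - t * σ) / speed q ^ 2) = v.1 * speed q - t * σ := by
    field_simp
  set η := (v.1 * speed q - t * σ) / speed q ^ 2
  set C := Real.cos (t / speed q)
  set S := Real.sin (t / speed q)
  set r := speed q
  set φ := t / r
  clear_value φ η σ S C r
  -- Component of the horizontal part along the rotated vector `e^{iφ} q`.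
  have hrad : r * (σ * C) = r * (r * S * η) := by
    linear_combination (q.1 * C - q.2 * S) * h1 + (q.2 * C + q.1 * S) * h2 + C * hσ -
      C * (q.1 * v.2.1 + q.2 * v.2.2) * hp - S * η * hr2
  have hrad := mul_left_cancel₀ hr.ne' hrad
  have hz : r * (σ * (φ + S * C) + r * η * C ^ 2) = 0 := by linear_combination 2 * h3
  have hz := (mul_eq_zero.1 hz).resolve_left hr.ne'
  -- Eliminating `η` leaves the factor `φ sin φ + cos φ`, positive for `|φ| < π / 2`.
  have hσ0 : σ = 0 := by
    have : σ * (φ * S + C) = 0 := by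
      linear_combination S * hz + C ^ 2 * hrad - σ * C * hp
    exact (mul_eq_zero.1 this).resolve_right (by linarith)
  rw [hσ0] at hz hη hσ
  have hη0 : η = 0 := by
    have : r * C ^ 2 * η = 0 := by linear_combination hz
    exact (mul_eq_zero.1 this).resolve_left (by positivity)
  rw [hη0] at h1 h2 hη
  have hv1 : v.1 = 0 := by
    have : v.1 * r = 0 := by linear_combination -hη
    exact (mul_eq_zero.1 this).resolve_right hr.ne'
  have h1 : v.2.1 * C - v.2.2 * S = 0 :=
    (mul_eq_zero.1 (by linear_combination h1 : C * (v.2.1 * C - v.2.2 * S) = 0)).resolve_left hC.ne'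
  have h2 : v.2.2 * C + v.2.1 * S = 0 :=
    (mul_eq_zero.1 (by linear_combination h2 : C * (v.2.2 * C + v.2.1 * S) = 0)).resolve_left hC.ne'
  refine Prod.ext hv1 (Prod.ext ?_ ?_)
  · change v.2.1 = 0
    linear_combination C * h1 + S * h2 - v.2.1 * hp
  · change v.2.2 = 0
    linear_combination C * h2 - S * h1 - v.2.2 * hp

theorem cos_quarter {σ : ℝ} (hσ : σ = 1 ∨ σ = -1) : Real.cos (σ * (Real.pi / 2)) = 0 := by
  rcases hσ with rfl | rfl <;> simp

theorem focalLocus_eq : focalLocus = zAxis \ {0} := by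
  have hpi := Real.pi_pos
  refine Set.Subset.antisymm ?_ fun p hp => ?_
  · rintro p ⟨t, q, hq, rfl, hcrit, hfirst⟩
    have hr := speed_pos hq
    have hge : Real.pi / 2 ≤ |t / speed q| := not_lt.1 fun h => not_isCriticalPoint hq h hcrit
    obtain ⟨σ, hσ, hσt⟩ := exists_sign_mul_abs (t / speed q)
    replace hσt := hσt.symm
    have heq : |t / speed q| = Real.pi / 2 := by
      by_contra hne
      have hlt := hge.lt_of_ne (Ne.symm hne)
      have hpos : 0 < |t / speed q| := by linarith
      -- If `|φ| > π / 2`, the geodesic was already critical when its half angle was `± π / 2`.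
      refine hfirst (Real.pi / 2 / |t / speed q|) (by positivity) ((div_lt_one hpos).2 hlt)
        (isCriticalPoint_of_cos_eq_zero hq ?_)
      have : Real.pi / 2 / |t / speed q| * t / speed q = σ * (Real.pi / 2) := by
        rw [mul_div_assoc, hσt, abs_mul, abs_abs,
          abs_sign hσ]
        field_simp
      rw [this, cos_quarter hσ]
    have ht : t = σ * (speed q * Real.pi / 2) := by
      rw [heq, div_eq_iff hr.ne'] at hσt
      linarith
    rw [ht, planeExp_quarter hq hσ]
    refine ⟨⟨rfl, rfl⟩, fun h => ?_⟩
    have h0 : σ * (speed q ^ 2 * Real.pi / 8) = 0 := congrArg (fun p : Pt => p.2.2) h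
    have h1 : 0 < speed q ^ 2 * Real.pi / 8 := by positivity
    rcases hσ with rfl | rfl <;> linarith
  · obtain ⟨r, σ, hr, hσ, -, hE⟩ := exists_planeExp_eq_axis (height_ne_zero hp)
    rw [eq_of_mem_zAxis hp.1]
    have hs := speed_axis hr.le
    have hq := ne_zero_of_speed_pos (hs.symm ▸ hr)
    have hang : ∀ c : ℝ, c * (σ * (r * Real.pi / 2)) / speed (r, 0) = σ * (c * (Real.pi / 2)) :=
      fun c => by rw [hs]; field_simp
    refine ⟨_, (r, 0), hq, hE _ hs, isCriticalPoint_of_cos_eq_zero hq ?_, fun c hc0 hc1 =>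
      not_isCriticalPoint hq ?_⟩
    · rw [← one_mul (σ * _), hang, one_mul, cos_quarter hσ]
    · rw [hang, abs_mul, abs_sign hσ, one_mul,
        abs_of_nonneg (by positivity)]
      nlinarith

/-! ### The distance formula off the axis -/

theorem radius_pos {p : Pt} (hp : p ∉ zAxis) : 0 < radius p := by
  refine (Real.sqrt_nonneg _).lt_of_ne fun h => hp ?_
  have h1 : p.1 ^ 2 + p.2.1 ^ 2 = 0 := (Real.sqrt_eq_zero (by positivity)).1 h.symm
  constructor <;> nlinarith [sq_nonneg p.1, sq_nonneg p.2.1]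

theorem heightRoot_xi_nonpos (p : Pt) : heightRoot (xi p) ≤ 0 := by
  have hroot := (eq_heightRoot_iff (xi p) _).2 rfl
  have hxi : 0 ≤ xi p := by unfold xi; positivity
  by_contra! hy
  have := mul_nonneg (by positivity : 0 ≤ 1 + heightRoot (xi p) ^ 2) (Real.arctan_nonneg.2 hy.le)
  linarith

/-- With `w = -y₀ ≥ 0`, the root equation reads `4 ξ + y₀ = (1 + w²) arctan w`, which turns `r √(1 +
w²) arctan w` into the stated quotient. -/
theorem planeDist_of_notMem_zAxis {p : Pt} (hp : p ∉ zAxis) :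
    planeDist p = ENNReal.ofReal (radius p *
      ((4 * xi p + heightRoot (xi p)) / Real.sqrt (1 + heightRoot (xi p) ^ 2))) := by
  have hr := radius_pos hp
  have hroot := (eq_heightRoot_iff (xi p) _).2 rfl
  have hy := heightRoot_xi_nonpos p
  have hz : |p.2.2| = xi p * radius p ^ 2 := by unfold xi; field_simp
  generalize heightRoot (xi p) = y at *
  rw [planeDist_of_tan hr (w := -y) (neg_nonneg.2 hy)
    (by rw [hz, Real.arctan_neg]; linear_combination radius p ^ 2 * hroot), neg_sq,
    Real.arctan_neg, show 4 * xi p + y = Real.sqrt (1 + y ^ 2) ^ 2 * -Real.arctan y by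
      rw [Real.sq_sqrt (by positivity)]; linear_combination hroot]
  have hS : 0 < Real.sqrt (1 + y ^ 2) := Real.sqrt_pos.2 (by positivity)
  congr 1
  field_simp

/-- Needed to recover the real value, since `ENNReal.ofReal` truncates negative numbers to `0`. -/
theorem heightFormula_nonneg (p : Pt) : 0 ≤ radius p *
    ((4 * xi p + heightRoot (xi p)) / Real.sqrt (1 + heightRoot (xi p) ^ 2)) := by
  have hroot := (eq_heightRoot_iff (xi p) _).2 rfl
  have hy := heightRoot_xi_nonpos p
  generalize heightRoot (xi p) = y at *
  have : (1 + y ^ 2) * Real.arctan y ≤ 0 :=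
    mul_nonpos_of_nonneg_of_nonpos (by positivity) (by simpa using Real.arctan_mono hy)
  exact mul_nonneg (Real.sqrt_nonneg _) (div_nonneg (by linarith) (Real.sqrt_nonneg _))

end Heisenberg

end

theorem theorem1p5 :
    (∀ p ∈ Heisenberg.zAxis, Heisenberg.planeDist p ≠ ⊤ ∧
      (Heisenberg.planeDist p).toReal = Real.sqrt (2 * Real.pi * |p.2.2|)) ∧
    (∃ y₀ : ℝ → ℝ, ContDiff ℝ ∞ y₀ ∧
      (∀ ξ y : ℝ, 4 * ξ + y + (1 + y ^ 2) * Real.arctan y = 0 ↔ y = y₀ ξ) ∧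
      (∀ p ∉ Heisenberg.zAxis, Heisenberg.planeDist p ≠ ⊤ ∧
        (Heisenberg.planeDist p).toReal =
          Heisenberg.radius p *
            ((4 * Heisenberg.xi p + y₀ (Heisenberg.xi p)) / Real.sqrt (1 + y₀ (Heisenberg.xi p) ^ 2)))) ∧
    Heisenberg.cutLocus = Heisenberg.zAxis \ {0} ∧
    Heisenberg.minimizingCutLocus = Heisenberg.zAxis \ {0} ∧
    Heisenberg.focalLocus = Heisenberg.zAxis \ {0} := by
  refine ⟨fun p hp => ?_, ⟨Heisenberg.heightRoot, Heisenberg.contDiff_heightRoot,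
    Heisenberg.eq_heightRoot_iff, fun p hp => ?_⟩, Heisenberg.cutLocus_eq,
    Heisenberg.minimizingCutLocus_eq, Heisenberg.focalLocus_eq⟩
  · rw [Heisenberg.eq_of_mem_zAxis hp, Heisenberg.planeDist_axis]
    exact ⟨ENNReal.ofReal_ne_top, ENNReal.toReal_ofReal (Real.sqrt_nonneg _)⟩
  · rw [Heisenberg.planeDist_of_notMem_zAxis hp]
    exact ⟨ENNReal.ofReal_ne_top, ENNReal.toReal_ofReal (Heisenberg.heightFormula_nonneg p)⟩
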